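/- Let $r,t\ge 2$ and $n$ be integers with $t\mid n$, and let $\alpha\in(0,1/2]$ be such that $m:=\alpha n/t$ is an integer. In the $r$-ary Hidden Hypermatching problem $r\text{-}\mathsf{HH}(\alpha,t,n)$, Alice gets $x\in\mathbb{Z}_r^n$, and Bob gets an $\alpha$-partial $t$-hypermatching $M$ on $[n]$, i.e. a sequence of $m$ pairwise disjoint hyperedges $(M_{i,1},\dots,M_{i,t})\in[n]^t$, each with $t$ distinct vertices, together with a string $w\in\mathbb{Z}_r^{m}$. Identify $M$ with its incidence matrix in $\{0,1\}^{m\times n}$. In a YES instance $w=Mx$ (over $\mathbb{Z}_r$); in a NO instance $w$ is uniformly random in $\mathbb{Z}_r^m$, independently of $(x,M)$. In a one-way protocol with $c$ bits of communication, Alice sends Bob a $c$-bit message depending on $x$, and Bob answers YES or NO from the message, $M$ and $w$; the players may use private and shared randomness. The protocol achieves advantage $\varepsilon$ if Bob's answer is correct with probability at least $\frac12+\varepsilon$ when $x$ and $M$ are uniformly random and independent and the instance is YES or NO with probability $\frac12$ each, independently of $(x,M)$. (In particular this holds for every protocol that is correct with probability at least $\frac12+\varepsilon$ for all $x$ and $M$,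 both on YES and on NO instances.) Theorem. There is a universal constant $\gamma>0$, independent of $r,t,n,\alpha,\varepsilon$, such that for every $\varepsilon>0$, every one-way classical protocol that achieves advantage $\varepsilon$ for $r\text{-}\mathsf{HH}(\alpha,t,n)$ with $t\ge2$ and $\alpha\le 1/2$ uses at least $$\gamma\, r^{-1}\Big(\frac{\varepsilon^4}{\alpha}\Big)^{1/t}\Big(\frac nt\Big)^{1-1/t}$$ bits of communication. -/

import Mathlib

namespace HiddenHypermatching

open scoped BigOperators

/-- A `t`-hypermatching with `m` hyperedges on the vertex set `Fin n`: a sequence of `m` pairwise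
disjoint `t`-tuples of distinct vertices, the `j`-th vertex of the `i`-th hyperedge being
`M (i, j)`. It is `α`-partial when `m = α n / t`. -/
abbrev Hypermatching (t n m : ℕ) : Type := (Fin m × Fin t) ↪ Fin n

/-- The `0/1` incidence matrix of a hypermatching (one row for each hyperedge), over `ℤ_r`. -/
def incidence (r : ℕ) {t n m : ℕ} (M : Hypermatching t n m) : Matrix (Fin m) (Fin n) (ZMod r) :=
  fun i v => if ∃ j, M (i, j) = v then 1 else 0

/-- A deterministic one-way protocol with `c` bits of communication. Alice, who sees only
`x ∈ ℤ_r^n`, sends a `c`-bit message. Bob sees the message, the hypermatching `M` and the string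
`w ∈ ℤ_r^m`, and outputs `true` for YES and `false` for NO. -/
structure DetProtocol (r t n m c : ℕ) where
  alice : (Fin n → ZMod r) → (Fin c → Bool)
  bob : (Fin c → Bool) → Hypermatching t n m → (Fin m → ZMod r) → Bool

/-- The probability that Bob's answer is right when `x` and `M` are uniform and independent, and,
with probability `1/2` each, `w = M x` (a YES instance) or `w` is uniform in `ℤ_r^m` and
independent of `(x, M)` (a NO instance). -/
noncomputable def DetProtocol.successProb {r t n m c : ℕ} [NeZero r]
    (D : DetProtocol r t n m c) : ℝ :=
  𝔼 x : Fin n → ZMod r, 𝔼 M : Hypermatching t n m,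
    ((1 / 2 : ℝ) * (if D.bob (D.alice x) M ((incidence r M).mulVec x) = true then 1 else 0) +
      (1 / 2 : ℝ) * 𝔼 w : Fin m → ZMod r, (if D.bob (D.alice x) M w = false then (1 : ℝ) else 0))

/-- A randomized one-way protocol with `c` bits of communication: a probability distribution over
deterministic ones. This allows shared randomness and private coins of both players. -/
abbrev Protocol (r t n m c : ℕ) : Type := PMF (DetProtocol r t n m c)

/-- The success probability of a randomized protocol, over its coins and over the inputs. -/
noncomputable def Protocol.successProb {r t n m c : ℕ} [NeZero r]
    (P : Protocol r t n m c) : ℝ :=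
  ∑' D : DetProtocol r t n m c, (P D).toReal * D.successProb

/-- Advantage (at least) `ε`: the success probability is at least `1/2 + ε`. -/
def Protocol.AchievesAdvantage {r t n m c : ℕ} [NeZero r]
    (P : Protocol r t n m c) (ε : ℝ) : Prop :=
  1 / 2 + ε ≤ Protocol.successProb P

end HiddenHypermatching

namespace HiddenHypermatching

open Finset
open scoped BigOperators

/-! Fix the coins. A message then tells Bob only that `x` lies in a set `A` of some density μ, and
messages with μ < ε/2^c matter little. For fixed `M`, Bob's squared bias is controlled by the L²
distance of `Mx` from uniform, hence by the Fourier coefficients of the indicator of `A` at the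
vectors `S M`, `S ≠ 0` (`sq_sum_mul_sub_mean_le`). Such a vector is supported exactly on a union of
k ≥ 1 hyperedges, and for random `M` that union is a uniform kt-set. So the mean squared bias is at
most Σ_k C(m,k)/C(n,kt) · W_{kt}, where W_d is the Fourier weight of `A` on level d
(`sum_hypermatching_le`).

A set of density at least ε/2^c has little weight on low levels. This is a level inequality
(`levelSum_energy_le`), obtained from a hypercontractive estimate on ℤ_r^n with noise rate ρ² of
order 1/(rs). Choosing s of order c/k for the level kt makes k cancel, so the term for k is at most
η^k μ²/ε with η = m(48rct/n)^t. For k > c the total weight, at most μ, suffices because the binomial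
ratio decreases in k. If η ≤ ε³/8, the geometric series leaves a bias of at most εμ/2 per message.
Together with the light messages the advantage is at most 3ε/4, which is a contradiction. The
claimed bound is the condition on η solved for c. -/

/-! ### Scalar inequalities and hypercontractivity at one site. -/

theorem pow_add_le_taylor {A z : ℝ} (hA : 0 ≤ A) (hz : 0 ≤ A + z) (k : ℕ) :
    (A + z) ^ (k + 2) ≤ A ^ (k + 2) + (k + 2) * A ^ (k + 1) * z
      + (k + 2) * (k + 1) / 2 * z ^ 2 * (A + |z|) ^ k := by
  induction k with
  | zero => simp; nlinarith
  | succ k ih =>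
    have h0 : 0 ≤ A + |z| := by positivity
    have h1 : A ^ (k + 1) ≤ (A + |z|) ^ (k + 1) := by
      gcongr; linarith [abs_nonneg z]
    have h2 : (A + z) * (A + |z|) ^ k ≤ (A + |z|) ^ (k + 1) := by
      rw [pow_succ']; gcongr; exact le_abs_self z
    have h3 := mul_le_mul_of_nonneg_left ih hz
    have h4 := mul_le_mul_of_nonneg_left h1 (by positivity : 0 ≤ ((k : ℝ) + 2) * z ^ 2)
    have h5 := mul_le_mul_of_nonneg_left h2
      (by positivity : 0 ≤ ((k : ℝ) + 2) * (k + 1) / 2 * z ^ 2)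
    push_cast
    calc (A + z) ^ (k + 1 + 2) = (A + z) * (A + z) ^ (k + 2) := by ring
      _ ≤ _ := h3
      _ = A ^ (k + 3) + (k + 3) * A ^ (k + 2) * z + (k + 2) * z ^ 2 * A ^ (k + 1)
          + (k + 2) * (k + 1) / 2 * z ^ 2 * ((A + z) * (A + |z|) ^ k) := by ring
      _ ≤ A ^ (k + 3) + (k + 3) * A ^ (k + 2) * z + (k + 2) * z ^ 2 * (A + |z|) ^ (k + 1)
          + (k + 2) * (k + 1) / 2 * z ^ 2 * (A + |z|) ^ (k + 1) := by linarith
      _ = _ := by ring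

/-- The two bounds are proved together because each feeds the induction step of the other. The first
is the midpoint (Hermite–Hadamard) bound for the convex derivative of a power. -/
theorem pow_add_sub_pow_sub_ge {P B : ℝ} (hB : 0 ≤ B) (hP : B ≤ P) (k : ℕ) :
    2 * (k + 1) * B * P ^ k ≤ (P + B) ^ (k + 1) - (P - B) ^ (k + 1) ∧
      2 * P ^ (k + 1) ≤ (P + B) ^ (k + 1) + (P - B) ^ (k + 1) := by
  have hP0 : 0 ≤ P := hB.trans hP
  induction k with
  | zero => constructor <;> (simp; linarith)
  | succ k ih =>
    obtain ⟨h1, h2⟩ := ih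
    have a1 := mul_le_mul_of_nonneg_left h1 hP0
    have a2 := mul_le_mul_of_nonneg_left h2 hB
    have a3 := mul_le_mul_of_nonneg_left h2 hP0
    have a4 : 0 ≤ B * ((P + B) ^ (k + 1) - (P - B) ^ (k + 1)) :=
      mul_nonneg hB (le_trans (by positivity) h1)
    push_cast
    constructor
    · calc 2 * ((k : ℝ) + 1 + 1) * B * P ^ (k + 1)
          = P * (2 * (k + 1) * B * P ^ k) + B * (2 * P ^ (k + 1)) := by ring
        _ ≤ _ := add_le_add a1 a2
        _ = _ := by ring
    · calc 2 * P ^ (k + 1 + 1) = P * (2 * P ^ (k + 1)) + 0 := by ring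
        _ ≤ _ := add_le_add a3 a4
        _ = _ := by ring

theorem pow_add_ge {A u : ℝ} (hA : 0 ≤ A) (hu : 0 ≤ u) (k : ℕ) :
    A ^ (k + 1) + (k + 1) * u * (A + u / 2) ^ k ≤ (A + u) ^ (k + 1) := by
  have h := (pow_add_sub_pow_sub_ge (P := A + u / 2) (B := u / 2) (by positivity)
    (by linarith) k).1
  rw [show A + u / 2 + u / 2 = A + u by ring, show A + u / 2 - u / 2 = A by ring] at h
  linarith

theorem one_add_one_div_pow_le_three (k : ℕ) : (1 + 1 / ((k : ℝ) + 2)) ^ (k + 1) ≤ 3 := by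
  have h := Real.one_add_inv_pow_le_exp (n := k + 2)
  push_cast at h
  rw [one_div]
  refine le_trans (pow_le_pow_right₀ ?_ (by omega : k + 1 ≤ k + 2)) (h.trans ?_)
  · have : (0 : ℝ) ≤ ((k : ℝ) + 2)⁻¹ := by positivity
    linarith
  · linarith [Real.exp_one_lt_d9]

/-- The scalar estimate behind the one-site hypercontractive inequality. -/
theorem quadratic_error_le {a y u : ℝ} (k : ℕ) (ha : 0 ≤ a) (hy : 0 ≤ y)
    (hyu : 8 * (k + 2) * y ^ 2 ≤ u) {z : ℝ} (hz : |z| ≤ 2 * a * y + y ^ 2) :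
    (k + 2) * (k + 1) / 2 * z ^ 2 * (a ^ 2 + |z|) ^ k ≤
      3 / 4 * (k + 2) * u * (a ^ 2 + u / 2) ^ (k + 1) := by
  have hu : 0 ≤ u := le_trans (by positivity) hyu
  have h1 : z ^ 2 ≤ 4 * y ^ 2 * (a + y) ^ 2 := by
    rw [← sq_abs]
    calc |z| ^ 2 ≤ (2 * a * y + y ^ 2) ^ 2 := by gcongr
      _ ≤ (2 * y * (a + y)) ^ 2 := by gcongr; nlinarith
      _ = _ := by ring
  have h2 : a ^ 2 + |z| ≤ (a + y) ^ 2 := by nlinarith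
  have hk : (0 : ℝ) < k + 2 := by positivity
  -- Young's inequality with weight `k + 2`. After raising to the power `k + 1`, the prefactor costs
  -- at most 3.
  have h3 : (a + y) ^ 2 ≤ (1 + 1 / ((k : ℝ) + 2)) * (a ^ 2 + u / 2) := by
    have : (a + y) ^ 2 ≤ (1 + 1 / ((k : ℝ) + 2)) * (a ^ 2 + (k + 2) * y ^ 2) := by
      have e : (1 + 1 / ((k : ℝ) + 2)) * (a ^ 2 + (k + 2) * y ^ 2) - (a + y) ^ 2
          = (a - (k + 2) * y) ^ 2 / (k + 2) := by field_simp; ring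
      have : 0 ≤ (a - (k + 2) * y) ^ 2 / ((k : ℝ) + 2) := by positivity
      linarith
    refine this.trans ?_
    gcongr
    nlinarith [mul_nonneg hk.le (sq_nonneg y)]
  calc ((k : ℝ) + 2) * (k + 1) / 2 * z ^ 2 * (a ^ 2 + |z|) ^ k
      ≤ (k + 2) * (k + 1) / 2 * (4 * y ^ 2 * (a + y) ^ 2) * ((a + y) ^ 2) ^ k := by gcongr
    _ = (k + 2) * (k + 1) * 2 * y ^ 2 * ((a + y) ^ 2) ^ (k + 1) := by ring
    _ ≤ (k + 2) * (k + 2) * 2 * y ^ 2 * ((1 + 1 / ((k : ℝ) + 2)) * (a ^ 2 + u / 2)) ^ (k + 1) := by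
        gcongr; norm_num
    _ = (k + 2) / 4 * (8 * (k + 2) * y ^ 2) * (1 + 1 / ((k : ℝ) + 2)) ^ (k + 1)
          * (a ^ 2 + u / 2) ^ (k + 1) := by rw [mul_pow]; ring
    _ ≤ (k + 2) / 4 * u * 3 * (a ^ 2 + u / 2) ^ (k + 1) := by
        gcongr; exact one_add_one_div_pow_le_three k
    _ = _ := by ring

/-- Hilbert-valued hypercontractivity for the noise operator on a uniform space of `r` points. -/
theorem one_site_hypercontractive {ι E : Type*} [Fintype ι] [Nonempty ι]
    [NormedAddCommGroup E] [InnerProductSpace ℝ E] (h : ι → E) {ρ : ℝ} (hρ : 0 ≤ ρ) (k : ℕ)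
    (hρr : 8 * (k + 2) * Fintype.card ι * ρ ^ 2 ≤ 1) :
    (∑ i, ‖ρ • h i + ((1 - ρ) / Fintype.card ι) • ∑ j, h j‖ ^ (2 * (k + 2))) / Fintype.card ι ≤
      ((∑ i, ‖h i‖ ^ 2) / Fintype.card ι) ^ (k + 2) := by
  set r : ℝ := ((Fintype.card ι : ℕ) : ℝ) with hr
  have hr1 : 1 ≤ r := by rw [hr]; exact_mod_cast Fintype.card_pos
  have hr0 : 0 < r := by linarith
  set a : E := r⁻¹ • ∑ j, h j with ha
  set g : ι → E := fun i => h i - a with hg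
  have hra : r • a = ∑ j, h j := by rw [ha, smul_inv_smul₀ hr0.ne']
  have hsum : ∑ i, g i = 0 := by
    simp only [hg, sum_sub_distrib, sum_const, card_univ, ← hra]
    rw [← Nat.cast_smul_eq_nsmul ℝ, sub_self]
  have hin : ∑ i, inner ℝ a (g i) = 0 := by rw [← inner_sum, hsum, inner_zero_right]
  set u : ℝ := (∑ i, ‖g i‖ ^ 2) / r with hu
  have hu0 : 0 ≤ u := by positivity
  have hru : r * u = ∑ i, ‖g i‖ ^ 2 := by rw [hu]; field_simp
  -- Passing from a mean to a pointwise bound costs a factor `r`. This forces ρ² to be of order 1/r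
  -- and is the source of the r⁻¹ in the theorem.
  have hgi : ∀ i, ‖g i‖ ^ 2 ≤ r * u := fun i => by
    rw [hru]
    exact single_le_sum (f := fun i => ‖g i‖ ^ 2) (fun _ _ => by positivity) (mem_univ i)
  have hmean : (∑ i, ‖h i‖ ^ 2) / r = ‖a‖ ^ 2 + u := by
    have : ∀ i, ‖h i‖ ^ 2 = ‖a‖ ^ 2 + 2 * inner ℝ a (g i) + ‖g i‖ ^ 2 := fun i => by
      rw [← norm_add_sq_real]; simp [hg]
    simp only [this, sum_add_distrib, ← mul_sum, hin, sum_const, card_univ, nsmul_eq_mul, ← hr,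
      ← hru]
    field_simp
    ring
  set z : ι → ℝ := fun i => 2 * ρ * inner ℝ a (g i) + ρ ^ 2 * ‖g i‖ ^ 2 with hz
  have hzs : (∑ i, z i) / r = ρ ^ 2 * u := by
    simp only [hz, sum_add_distrib, ← mul_sum, hin, ← hru]
    field_simp
    ring
  have hpt : ∀ i, ‖ρ • h i + ((1 - ρ) / r) • ∑ j, h j‖ ^ 2 = ‖a‖ ^ 2 + z i := fun i => by
    have : ρ • h i + ((1 - ρ) / r) • ∑ j, h j = a + ρ • g i := by
      rw [← hra, smul_smul, div_mul_cancel₀ _ hr0.ne', hg]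
      simp only [smul_sub, sub_smul, one_smul]
      abel
    have h2 : ‖ρ • g i‖ ^ 2 = ρ ^ 2 * ‖g i‖ ^ 2 := by
      rw [norm_smul, mul_pow, Real.norm_eq_abs, sq_abs]
    rw [this, norm_add_sq_real, inner_smul_right, h2]
    ring
  set y : ℝ := ρ * √(r * u) with hy
  have hy0 : 0 ≤ y := by positivity
  have hy2 : y ^ 2 = ρ ^ 2 * (r * u) := by rw [hy, mul_pow, Real.sq_sqrt (by positivity)]
  have hyu : 8 * ((k : ℝ) + 2) * y ^ 2 ≤ u := by
    rw [hy2]; nlinarith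
  have hzi : ∀ i, |z i| ≤ 2 * ‖a‖ * y + y ^ 2 := fun i => by
    have h1 : ρ * ‖g i‖ ≤ y := by
      rw [hy]; gcongr; exact Real.le_sqrt_of_sq_le (hgi i)
    have h2 := abs_real_inner_le_norm a (g i)
    calc |z i| ≤ |2 * ρ * inner ℝ a (g i)| + |ρ ^ 2 * ‖g i‖ ^ 2| := abs_add_le _ _
      _ = 2 * ρ * |inner ℝ a (g i)| + (ρ * ‖g i‖) ^ 2 := by
          rw [abs_mul, abs_of_nonneg (by positivity : 0 ≤ 2 * ρ), abs_of_nonneg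
            (by positivity : 0 ≤ ρ ^ 2 * ‖g i‖ ^ 2), mul_pow]
      _ ≤ 2 * ρ * (‖a‖ * ‖g i‖) + (ρ * ‖g i‖) ^ 2 := by gcongr
      _ = 2 * ‖a‖ * (ρ * ‖g i‖) + (ρ * ‖g i‖) ^ 2 := by ring
      _ ≤ _ := by gcongr
  have hbound : ∀ i, ‖ρ • h i + ((1 - ρ) / r) • ∑ j, h j‖ ^ (2 * (k + 2)) ≤
      (‖a‖ ^ 2) ^ (k + 2) + (k + 2) * (‖a‖ ^ 2) ^ (k + 1) * z i
        + 3 / 4 * (k + 2) * u * (‖a‖ ^ 2 + u / 2) ^ (k + 1) := fun i => by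
    rw [pow_mul, hpt]
    refine (pow_add_le_taylor (by positivity) (by rw [← hpt]; positivity) k).trans ?_
    refine add_le_add le_rfl ?_
    exact quadratic_error_le k (norm_nonneg a) hy0 hyu (hzi i)
  -- The Taylor term linear in `z` averages to a multiple of ρ²u. With ρ² ≤ 1/4 it fills exactly the
  -- quarter left free by the 3/4 in `quadratic_error_le`, and `pow_add_ge` absorbs the sum.
  have hρ2 : ρ ^ 2 ≤ 1 / 4 := by
    have : 1 ≤ ((k : ℝ) + 2) * r := by nlinarith [(Nat.cast_nonneg k : (0 : ℝ) ≤ k)]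
    nlinarith [mul_le_mul_of_nonneg_right this (sq_nonneg ρ)]
  rw [hmean]
  calc (∑ i, ‖ρ • h i + ((1 - ρ) / r) • ∑ j, h j‖ ^ (2 * (k + 2))) / r
      ≤ (∑ i, ((‖a‖ ^ 2) ^ (k + 2) + (k + 2) * (‖a‖ ^ 2) ^ (k + 1) * z i
        + 3 / 4 * (k + 2) * u * (‖a‖ ^ 2 + u / 2) ^ (k + 1))) / r := by
        gcongr with i; exact hbound i
    _ = (‖a‖ ^ 2) ^ (k + 2) + (k + 2) * (‖a‖ ^ 2) ^ (k + 1) * ((∑ i, z i) / r)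
        + 3 / 4 * (k + 2) * u * (‖a‖ ^ 2 + u / 2) ^ (k + 1) := by
        simp only [sum_add_distrib, ← mul_sum, sum_const, card_univ, nsmul_eq_mul, ← hr]
        field_simp
    _ ≤ (‖a‖ ^ 2) ^ (k + 2) + (k + 2) * (‖a‖ ^ 2 + u / 2) ^ (k + 1) * (1 / 4 * u)
        + 3 / 4 * (k + 2) * u * (‖a‖ ^ 2 + u / 2) ^ (k + 1) := by
        rw [hzs]
        gcongr
        linarith
    _ = (‖a‖ ^ 2) ^ (k + 1 + 1) + (((k + 1 : ℕ) : ℝ) + 1) * u * (‖a‖ ^ 2 + u / 2) ^ (k + 1) := by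
        push_cast; ring
    _ ≤ _ := pow_add_ge (by positivity) hu0 (k + 1)

/-! ### The noise operator on ℤ_r^n and its hypercontractivity. -/

section Noise

variable {r : ℕ}

/-- The transition kernel of the noise operator on one copy of `ℤ_r`. -/
noncomputable def siteKernel (r : ℕ) (ρ : ℝ) (a b : ZMod r) : ℝ :=
  (if a = b then ρ else 0) + (1 - ρ) / r

theorem siteKernel_comm (ρ : ℝ) (a b : ZMod r) : siteKernel r ρ a b = siteKernel r ρ b a := by
  simp [siteKernel, eq_comm]

theorem siteKernel_nonneg {ρ : ℝ} (h0 : 0 ≤ ρ) (h1 : ρ ≤ 1) (a b : ZMod r) :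
    0 ≤ siteKernel r ρ a b := by
  have : 0 ≤ (1 - ρ) / (r : ℝ) := div_nonneg (by linarith) (by positivity)
  unfold siteKernel
  split_ifs <;> linarith

variable [NeZero r]

/-- The noise operator on functions on `ℤ_r^n`: every coordinate is kept with probability `ρ` and
resampled otherwise. -/
noncomputable def noise {n : ℕ} (ρ : ℝ) (h : (Fin n → ZMod r) → ℝ) (x : Fin n → ZMod r) : ℝ :=
  ∑ y, (∏ i, siteKernel r ρ (x i) (y i)) * h y

theorem noise_nonneg {n : ℕ} {ρ : ℝ} (h0 : 0 ≤ ρ) (h1 : ρ ≤ 1) {h : (Fin n → ZMod r) → ℝ}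
    (hh : ∀ x, 0 ≤ h x) (x) : 0 ≤ noise ρ h x :=
  sum_nonneg fun y _ => mul_nonneg (prod_nonneg fun _ _ => siteKernel_nonneg h0 h1 _ _) (hh y)

theorem sum_mul_noise_comm {n : ℕ} (ρ : ℝ) (f g : (Fin n → ZMod r) → ℝ) :
    ∑ x, f x * noise ρ g x = ∑ x, noise ρ f x * g x := by
  simp only [noise, mul_sum, sum_mul]
  rw [sum_comm]
  refine sum_congr rfl fun x _ => sum_congr rfl fun y _ => ?_
  simp only [siteKernel_comm ρ (y _)]
  ring

theorem sum_fin_cons {n : ℕ} {β M : Type*} [Fintype β] [AddCommMonoid M]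
    (F : (Fin (n + 1) → β) → M) :
    ∑ x, F x = ∑ a, ∑ x : Fin n → β, F (Fin.cons a x) := by
  rw [← Fintype.sum_prod_type' (f := fun a x => F (Fin.cons a x))]
  exact (Fintype.sum_equiv (Fin.consEquiv fun _ => β) _ _ fun _ => rfl).symm

theorem noise_cons {n : ℕ} (ρ : ℝ) (h : (Fin (n + 1) → ZMod r) → ℝ) (a : ZMod r)
    (x : Fin n → ZMod r) :
    noise ρ h (Fin.cons a x) =
      noise ρ (fun y => ∑ b, siteKernel r ρ a b * h (Fin.cons b y)) x := by
  simp only [noise]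
  rw [sum_fin_cons, sum_comm]
  refine sum_congr rfl fun y _ => ?_
  rw [mul_sum]
  refine sum_congr rfl fun b _ => ?_
  rw [Fin.prod_univ_succ]
  simp only [Fin.cons_zero, Fin.cons_succ]
  ring

/-- Induction on `n`, splitting off the first coordinate. The induction hypothesis handles the
remaining coordinates, and the slices, viewed as vectors of a Euclidean space, are then treated by
the one-site inequality. This is why that inequality is Hilbert-valued. -/
theorem hypercontractive {ρ : ℝ} (hρ : 0 ≤ ρ) (k : ℕ) (hρr : 8 * (k + 2) * r * ρ ^ 2 ≤ 1)
    {n : ℕ} (h : (Fin n → ZMod r) → ℝ) :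
    (∑ x, noise ρ h x ^ (2 * (k + 2))) / (r : ℝ) ^ n ≤
      ((∑ x, h x ^ 2) / (r : ℝ) ^ n) ^ (k + 2) := by
  have hr0 : (0 : ℝ) < r := by exact_mod_cast Nat.pos_of_ne_zero (NeZero.ne r)
  induction n with
  | zero => simp [noise, pow_mul]
  | succ n ih =>
    set v : ZMod r → EuclideanSpace ℝ (Fin n → ZMod r) :=
      fun b => WithLp.toLp 2 fun y => h (Fin.cons b y) with hv
    set w : ZMod r → EuclideanSpace ℝ (Fin n → ZMod r) :=
      fun a => ρ • v a + ((1 - ρ) / r) • ∑ j, v j with hw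
    have hone := one_site_hypercontractive v hρ k (by rw [ZMod.card]; exact hρr)
    rw [ZMod.card] at hone
    have hwy : ∀ a y, w a y = ∑ b, siteKernel r ρ a b * h (Fin.cons b y) := fun a y => by
      simp [hw, hv, siteKernel, add_mul, sum_add_distrib, ite_mul, mul_sum]
    have hvn : ∀ b, ‖v b‖ ^ 2 = ∑ y, h (Fin.cons b y) ^ 2 := fun b => by
      simp [EuclideanSpace.norm_sq_eq, hv]
    have hwn : ∀ a, ‖w a‖ ^ 2 = ∑ y, (∑ b, siteKernel r ρ a b * h (Fin.cons b y)) ^ 2 := fun a => by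
      simp only [EuclideanSpace.norm_sq_eq, hwy, Real.norm_eq_abs, sq_abs]
    have hr : (r : ℝ) ^ n ≠ 0 := by positivity
    calc (∑ x, noise ρ h x ^ (2 * (k + 2))) / (r : ℝ) ^ (n + 1)
        = (∑ a, (∑ x : Fin n → ZMod r, noise ρ (fun y => ∑ b, siteKernel r ρ a b *
            h (Fin.cons b y)) x ^ (2 * (k + 2))) / (r : ℝ) ^ n) / r := by
          rw [sum_fin_cons, ← sum_div, div_div, pow_succ]
          simp only [noise_cons]
      _ ≤ (∑ a, (‖w a‖ ^ 2 / (r : ℝ) ^ n) ^ (k + 2)) / r := by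
          gcongr with a
          rw [hwn]
          exact ih _
      _ = ((∑ a, ‖w a‖ ^ (2 * (k + 2))) / r) / ((r : ℝ) ^ n) ^ (k + 2) := by
          simp only [div_pow, ← pow_mul, ← sum_div]
          rw [div_right_comm]
      _ ≤ ((∑ b, ‖v b‖ ^ 2) / r) ^ (k + 2) / ((r : ℝ) ^ n) ^ (k + 2) := by gcongr
      _ = _ := by
          rw [← div_pow, div_div, sum_fin_cons, pow_succ' (r : ℝ) n]
          simp only [hvn]

/-- For a set `A` of density `μ`, `‖T_ρ 1_A‖₂² ≤ μ^{2 - 1/s}`, with `s = k + 2`. -/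
theorem noise_indicator_energy_le {ρ : ℝ} (hρ : 0 ≤ ρ) (hρ1 : ρ ≤ 1) (k : ℕ)
    (hρr : 8 * (k + 2) * r * ρ ^ 2 ≤ 1) {n : ℕ} (A : Finset (Fin n → ZMod r)) :
    ((∑ x, noise ρ (fun x => if x ∈ A then 1 else 0) x ^ 2) / (r : ℝ) ^ n) ^ (k + 2) ≤
      (#A / (r : ℝ) ^ n) ^ (2 * k + 3) := by
  have hr0 : (0 : ℝ) < r := by exact_mod_cast Nat.pos_of_ne_zero (NeZero.ne r)
  set f : (Fin n → ZMod r) → ℝ := fun x => if x ∈ A then 1 else 0 with hf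
  set N : ℝ := (r : ℝ) ^ n with hN
  have hN0 : 0 < N := by positivity
  set X : ℝ := (∑ x, noise ρ f x ^ 2) / N with hX
  have hX0 : 0 ≤ X := by positivity
  rcases hX0.eq_or_lt with h0 | hXpos
  · rw [← h0, zero_pow (by omega : k + 2 ≠ 0)]
    exact pow_nonneg (div_nonneg (Nat.cast_nonneg _) hN0.le) _
  rcases A.eq_empty_or_nonempty with rfl | hA
  · have : X = 0 := by simp [hX, hf, noise]
    exact absurd this hXpos.ne'
  have hA0 : (0 : ℝ) < #A := by exact_mod_cast hA.card_pos
  set g := noise ρ (noise ρ f) with hg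
  have hg0 : ∀ x, 0 ≤ g x := noise_nonneg hρ hρ1 (noise_nonneg hρ hρ1 fun x => by
    show (0 : ℝ) ≤ if x ∈ A then 1 else 0; split_ifs <;> norm_num)
  have h1 : N * X = ∑ x ∈ A, g x := by
    rw [hX, mul_div_cancel₀ _ hN0.ne']
    have := sum_mul_noise_comm ρ f (noise ρ f)
    simp only [pow_two]
    rw [← this]
    simp only [f, ite_mul, one_mul, zero_mul, sum_ite_mem, univ_inter]; rfl
  -- Duality: `N * X` is the sum of the twice-noised indicator over `A`. The power mean inequality
  -- on `A` and hypercontractivity applied to the once-noised indicator bound it by a power of `X`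
  -- itself, and `X ^ (k + 2)` is then cancelled.
  have h2 := pow_sum_div_card_le_sum_pow (s := A) (fun x _ => hg0 x) (2 * k + 3)
  rw [← h1, div_le_iff₀ (by positivity)] at h2
  have h3 : ∑ x ∈ A, g x ^ (2 * (k + 2)) ≤ N * X ^ (k + 2) := by
    have h4 := hypercontractive hρ k hρr (noise ρ f)
    rw [div_le_iff₀ hN0, mul_comm _ N] at h4
    refine le_trans ?_ h4
    exact sum_le_sum_of_subset_of_nonneg (subset_univ A)
      fun _ _ _ => (even_two_mul _).pow_nonneg _
  have h5 : (N * X) ^ (2 * k + 3 + 1) ≤ N * X ^ (k + 2) * (#A : ℝ) ^ (2 * k + 3) :=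
    h2.trans (mul_le_mul_of_nonneg_right h3 (by positivity))
  rw [div_pow (#A : ℝ) N, le_div_iff₀ (by positivity)]
  have h6 : N * X ^ (k + 2) * (X ^ (k + 2) * N ^ (2 * k + 3)) ≤
      N * X ^ (k + 2) * (#A : ℝ) ^ (2 * k + 3) := by
    refine le_trans (le_of_eq ?_) h5
    ring
  exact le_of_mul_le_mul_left h6 (by positivity)

end Noise

/-! ### Fourier analysis on ℤ_r^ι. -/

section Fourier

variable {r : ℕ} [NeZero r] {ι : Type*} [Fintype ι]

open Matrix

theorem stdAddChar_dotProduct (V x : ι → ZMod r) :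
    (ZMod.stdAddChar (V ⬝ᵥ x) : ℂ) = ∏ i, (ZMod.stdAddChar (V i * x i) : ℂ) := by
  have h := map_prod (ZMod.stdAddChar (N := r)).toMonoidHom
    (fun i => Multiplicative.ofAdd (V i * x i)) univ
  simpa [dotProduct, ← ofAdd_sum] using h

variable [DecidableEq ι]

/-- The (unnormalised) Fourier transform on `ℤ_r^ι`. -/
noncomputable def fourier (f : (ι → ZMod r) → ℝ) (V : ι → ZMod r) : ℂ :=
  ∑ x, (f x : ℂ) * ZMod.stdAddChar (V ⬝ᵥ x)

theorem sum_prod_apply (F : ι → ZMod r → ℂ) :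
    ∑ x : ι → ZMod r, ∏ i, F i (x i) = ∏ i, ∑ a, F i a := by
  rw [prod_univ_sum, Fintype.piFinset_univ]

theorem sum_stdAddChar_mul (v : ZMod r) :
    ∑ a : ZMod r, (ZMod.stdAddChar (v * a) : ℂ) = if v = 0 then (r : ℂ) else 0 := by
  simp only [mul_comm v]
  rw [AddChar.sum_mulShift v (ZMod.isPrimitive_stdAddChar r), ZMod.card]
  split_ifs <;> simp

theorem sum_stdAddChar_dotProduct (z : ι → ZMod r) :
    ∑ V : ι → ZMod r, (ZMod.stdAddChar (V ⬝ᵥ z) : ℂ) =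
      if z = 0 then (r : ℂ) ^ Fintype.card ι else 0 := by
  simp only [dotProduct_comm _ z, stdAddChar_dotProduct]
  rw [sum_prod_apply fun i a => (ZMod.stdAddChar (z i * a) : ℂ)]
  simp only [sum_stdAddChar_mul]
  split_ifs with h
  · simp [h]
  · obtain ⟨i, hi⟩ := Function.ne_iff.1 h
    exact prod_eq_zero (mem_univ i) (by rw [if_neg (by simpa using hi)])

theorem parseval (f : (ι → ZMod r) → ℝ) :
    ∑ V, ‖fourier f V‖ ^ 2 = (r : ℝ) ^ Fintype.card ι * ∑ x, f x ^ 2 := by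
  have key : ∀ V, ((‖fourier f V‖ ^ 2 : ℝ) : ℂ) =
      ∑ x, ∑ y, (f x : ℂ) * f y * ZMod.stdAddChar (V ⬝ᵥ (x - y)) := fun V => by
    rw [Complex.ofReal_pow, ← Complex.mul_conj', fourier, map_sum, sum_mul_sum]
    refine sum_congr rfl fun x _ => sum_congr rfl fun y _ => ?_
    rw [map_mul, Complex.conj_ofReal, ← AddChar.map_neg_eq_conj, dotProduct_sub, sub_eq_add_neg,
      AddChar.map_add_eq_mul]
    ring
  apply Complex.ofReal_injective
  push_cast
  have := sum_congr rfl fun V (_ : V ∈ (univ : Finset (ι → ZMod r))) => key V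
  push_cast at this
  rw [this, sum_comm]
  rw [mul_sum]
  refine sum_congr rfl fun x _ => ?_
  rw [sum_comm]
  simp only [← mul_sum, sum_stdAddChar_dotProduct, sub_eq_zero]
  rw [sum_eq_single x] <;> simp +contextual [eq_comm]
  ring

theorem sum_siteKernel_mul_stdAddChar (ρ : ℝ) (b v : ZMod r) :
    ∑ a, (siteKernel r ρ a b : ℂ) * ZMod.stdAddChar (v * a) =
      (if v = 0 then 1 else (ρ : ℂ)) * ZMod.stdAddChar (v * b) := by
  have hr : (r : ℂ) ≠ 0 := by exact_mod_cast NeZero.ne r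
  simp only [siteKernel, Complex.ofReal_add, add_mul, sum_add_distrib, ← mul_sum,
    sum_stdAddChar_mul]
  have : ∑ a : ZMod r, (((if a = b then ρ else 0 : ℝ) : ℂ)) * ZMod.stdAddChar (v * a) =
      ρ * ZMod.stdAddChar (v * b) := by
    rw [sum_eq_single b] <;> simp +contextual
  rw [this]
  split_ifs with h
  · simp [h, hr]
  · simp

/-- The support of a vector. -/
def supp {κ : Type*} [Fintype κ] (V : κ → ZMod r) : Finset κ := univ.filter fun i => V i ≠ 0

/-- Characters are eigenfunctions of the site kernel: the trivial one has eigenvalue 1, every other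
one ρ. -/
theorem fourier_noise {n : ℕ} (ρ : ℝ) (f : (Fin n → ZMod r) → ℝ) (V : Fin n → ZMod r) :
    fourier (noise ρ f) V = (ρ : ℂ) ^ #(supp V) * fourier f V := by
  simp only [fourier, noise, Complex.ofReal_sum, sum_mul, mul_sum]
  rw [sum_comm]
  refine sum_congr rfl fun y _ => ?_
  have : ∀ x : Fin n → ZMod r,
      (((∏ i, siteKernel r ρ (x i) (y i)) * f y : ℝ) : ℂ) * ZMod.stdAddChar (V ⬝ᵥ x) =
      f y * ∏ i, ((siteKernel r ρ (x i) (y i) : ℂ) * ZMod.stdAddChar (V i * x i)) := fun x => by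
    rw [prod_mul_distrib, stdAddChar_dotProduct]
    push_cast
    ring
  simp only [this, ← mul_sum]
  rw [sum_prod_apply fun i a => (siteKernel r ρ a (y i) : ℂ) * ZMod.stdAddChar (V i * a)]
  simp only [sum_siteKernel_mul_stdAddChar, prod_mul_distrib, ← stdAddChar_dotProduct]
  rw [prod_ite, prod_const_one, one_mul, prod_const, supp]
  ring

end Fourier

/-! ### Level weights of a set, and the bias of a test on a linear image. -/

section Level

variable {r : ℕ} [NeZero r] {n : ℕ}

open Matrix

/-- The indicator function of a finite set of points. -/
def ind (A : Finset (Fin n → ZMod r)) (x : Fin n → ZMod r) : ℝ := if x ∈ A then 1 else 0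

/-- The normalised squared Fourier coefficient, with the trivial one removed. -/
noncomputable def energy (f : (Fin n → ZMod r) → ℝ) (V : Fin n → ZMod r) : ℝ :=
  if V = 0 then 0 else ‖fourier f V‖ ^ 2 / ((r : ℝ) ^ n) ^ 2

/-- The sum of `G` over the vectors of Hamming weight `d`. -/
noncomputable def levelSum (G : (Fin n → ZMod r) → ℝ) (d : ℕ) : ℝ :=
  ∑ V with #(supp V) = d, G V

theorem energy_nonneg (f : (Fin n → ZMod r) → ℝ) (V : Fin n → ZMod r) : 0 ≤ energy f V := by
  unfold energy; split_ifs <;> positivity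

theorem levelSum_nonneg {G : (Fin n → ZMod r) → ℝ} (hG : ∀ V, 0 ≤ G V) (d : ℕ) :
    0 ≤ levelSum G d := sum_nonneg fun V _ => hG V

theorem sum_ind (A : Finset (Fin n → ZMod r)) : ∑ x, ind A x = #A := by simp [ind]

theorem sum_ind_sq (A : Finset (Fin n → ZMod r)) : ∑ x, ind A x ^ 2 = #A := by simp [ind]

theorem levelSum_energy_zero (f : (Fin n → ZMod r) → ℝ) : levelSum (energy f) 0 = 0 := by
  refine sum_eq_zero fun V hV => if_pos ?_
  funext i
  have := (mem_filter.1 hV).2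
  rw [card_eq_zero] at this
  by_contra h
  have : i ∈ supp V := by simpa [supp] using h
  simp_all

theorem sum_energy (A : Finset (Fin n → ZMod r)) :
    ∑ V, energy (ind A) V = #A / (r : ℝ) ^ n - (#A / (r : ℝ) ^ n) ^ 2 := by
  have hr0 : (0 : ℝ) < r := by exact_mod_cast Nat.pos_of_ne_zero (NeZero.ne r)
  have h0 : ‖fourier (ind A) 0‖ ^ 2 = (#A : ℝ) ^ 2 := by
    have : fourier (ind A) 0 = ((#A : ℝ) : ℂ) := by
      rw [← sum_ind A]; simp [fourier]
    rw [this, Complex.norm_real, Real.norm_eq_abs, sq_abs]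
  have hp := parseval (ind A)
  rw [sum_ind_sq, Fintype.card_fin, ← add_sum_erase _ _ (mem_univ 0), h0] at hp
  have : ∑ V, energy (ind A) V = ∑ V ∈ univ.erase 0, ‖fourier (ind A) V‖ ^ 2 / ((r : ℝ) ^ n) ^ 2 := by
    rw [← add_sum_erase _ _ (mem_univ 0)]
    simp only [energy, if_true, zero_add]
    exact sum_congr rfl fun V hV => if_neg (ne_of_mem_erase hV)
  rw [this, ← sum_div]
  field_simp
  linarith

theorem sum_levelSum_le {G : (Fin n → ZMod r) → ℝ} (hG : ∀ V, 0 ≤ G V) {t : ℕ} (ht : 0 < t)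
    (K : Finset ℕ) : ∑ k ∈ K, levelSum G (k * t) ≤ ∑ V, G V := by
  classical
  simp only [levelSum]
  rw [← sum_biUnion]
  · exact sum_le_sum_of_subset_of_nonneg (subset_univ _) fun V _ _ => hG V
  · intro a _ b _ hab
    refine disjoint_left.2 fun V h1 h2 => hab ?_
    simp only [mem_filter] at h1 h2
    exact Nat.eq_of_mul_eq_mul_right ht (h1.2.symm.trans h2.2)

/-- Noise damps level `d` by only ρ^(2d), so that level is at most ρ^(-2d) times the noised energy.
Each factor 16 is 8 from ρ^(-2) times 2 from the density. -/
theorem levelSum_energy_le (hr : 2 ≤ r) {c d k : ℕ} (hcd : c ≤ d * (k + 2)) {ε : ℝ} (hε : 0 < ε)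
    (hε1 : ε ≤ 1) (A : Finset (Fin n → ZMod r)) (hA : ε ≤ 2 ^ c * (#A / (r : ℝ) ^ n)) :
    levelSum (energy (ind A)) d ≤
      (16 * (k + 2) * r) ^ d * (#A / (r : ℝ) ^ n) ^ 2 / ε := by
  have hr0 : (2 : ℝ) ≤ r := by exact_mod_cast hr
  set μ : ℝ := #A / (r : ℝ) ^ n with hμ
  set ρ : ℝ := √(1 / (8 * (k + 2) * r)) with hρ
  have hρ2 : ρ ^ 2 = 1 / (8 * (k + 2) * r) := Real.sq_sqrt (by positivity)
  have hρ0 : 0 < ρ := by positivity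
  have hρ1 : ρ ≤ 1 := by
    refine (sq_le_one_iff₀ hρ0.le).1 ?_
    rw [hρ2, div_le_one (by positivity)]
    nlinarith [(Nat.cast_nonneg k : (0 : ℝ) ≤ k)]
  have hμ0 : 0 < μ := by
    by_contra h
    have : (2 : ℝ) ^ c * μ ≤ 0 := mul_nonpos_of_nonneg_of_nonpos (by positivity) (not_lt.1 h)
    linarith
  set X : ℝ := (∑ x, noise ρ (ind A) x ^ 2) / (r : ℝ) ^ n with hX
  have hX0 : 0 ≤ X := by positivity
  have h1 : X ^ (k + 2) ≤ μ ^ (2 * k + 3) :=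
    noise_indicator_energy_le hρ0.le hρ1 k (by rw [hρ2]; field_simp; rfl) A
  have h2 : X = ∑ V, (ρ ^ #(supp V)) ^ 2 * (‖fourier (ind A) V‖ ^ 2 / ((r : ℝ) ^ n) ^ 2) := by
    have hp := parseval (noise ρ (ind A))
    have hN : (r : ℝ) ^ n ≠ 0 := by positivity
    rw [Fintype.card_fin] at hp
    have : X = (∑ V, ‖fourier (noise ρ (ind A)) V‖ ^ 2) / ((r : ℝ) ^ n) ^ 2 := by
      rw [hp, hX]; field_simp
    rw [this, sum_div]
    refine sum_congr rfl fun V _ => ?_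
    rw [fourier_noise, norm_mul, norm_pow, Complex.norm_real, Real.norm_eq_abs,
      abs_of_nonneg hρ0.le]
    ring
  have h3 : (ρ ^ 2) ^ d * levelSum (energy (ind A)) d ≤ X := by
    rw [h2, levelSum, mul_sum]
    refine le_trans (sum_le_sum fun V hV => ?_)
      (sum_le_sum_of_subset_of_nonneg (subset_univ _) fun V _ _ => by positivity)
    rw [(mem_filter.1 hV).2, ← pow_mul, ← pow_mul, mul_comm 2 d]
    gcongr
    unfold energy
    split_ifs
    · positivity
    · rfl
  -- The missing factor of μ is traded for 2^c/ε. Taking the root of order `k + 2` turns 2^c into at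
  -- most 2^d, and 1/ε stays bounded by itself since ε ≤ 1.
  have h4 : X ≤ μ ^ 2 * 2 ^ d / ε := by
    refine le_of_pow_le_pow_left₀ (n := k + 2) (by omega) (by positivity) (h1.trans ?_)
    rw [div_pow _ ε, le_div_iff₀ (by positivity), mul_pow, ← pow_mul, ← pow_mul]
    calc μ ^ (2 * k + 3) * ε ^ (k + 2) ≤ μ ^ (2 * k + 3) * ε := by
          gcongr
          exact pow_le_of_le_one hε.le hε1 (by omega)
      _ ≤ μ ^ (2 * k + 3) * (2 ^ c * μ) := by gcongr
      _ = μ ^ (2 * (k + 2)) * 2 ^ c := by ring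
      _ ≤ _ := by
          gcongr
          norm_num
  have h5 : (8 * ((k : ℝ) + 2) * r) ^ d * (ρ ^ 2) ^ d = 1 := by
    rw [← mul_pow, hρ2, mul_one_div_cancel (by positivity), one_pow]
  calc levelSum (energy (ind A)) d
      = (8 * ((k : ℝ) + 2) * r) ^ d * ((ρ ^ 2) ^ d * levelSum (energy (ind A)) d) := by
        rw [← mul_assoc, h5, one_mul]
    _ ≤ (8 * ((k : ℝ) + 2) * r) ^ d * (μ ^ 2 * 2 ^ d / ε) := by
        gcongr; exact h3.trans h4
    _ = _ := by
        rw [show (16 * ((k : ℝ) + 2) * r) = 8 * (k + 2) * r * 2 by ring, mul_pow _ (2 : ℝ)]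
        ring

/-- The distinguishing advantage of a test on the image of `f` under a matrix is controlled by the
Fourier coefficients of `f` in the row space. -/
theorem sq_sum_mul_sub_mean_le {m : ℕ} (f : (Fin n → ZMod r) → ℝ)
    (L : Matrix (Fin m) (Fin n) (ZMod r)) (B : (Fin m → ZMod r) → ℝ) (hB : ∀ w, |B w| ≤ 1) :
    (∑ x, f x * (B (L *ᵥ x) - (∑ w, B w) / (r : ℝ) ^ m)) ^ 2 ≤
      ∑ S with S ≠ 0, ‖fourier f (S ᵥ* L)‖ ^ 2 := by
  have hr0 : (0 : ℝ) < r := by exact_mod_cast Nat.pos_of_ne_zero (NeZero.ne r)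
  have hrc : (r : ℂ) ≠ 0 := by exact_mod_cast NeZero.ne r
  -- The pushforward of `f` under `L` minus its uniform average. Its transform vanishes at 0 and is
  -- that of `f` at `S ᵥ* L` elsewhere, so Cauchy–Schwarz and Parseval on ℤ_r^m finish.
  set p : (Fin m → ZMod r) → ℝ :=
    fun w => ∑ x, f x * ((if L *ᵥ x = w then 1 else 0) - 1 / (r : ℝ) ^ m) with hp
  have h1 : ∑ x, f x * (B (L *ᵥ x) - (∑ w, B w) / (r : ℝ) ^ m) = ∑ w, p w * B w := by
    simp only [hp, sum_mul]
    rw [sum_comm]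
    refine sum_congr rfl fun x _ => ?_
    simp only [mul_assoc, ← mul_sum, sub_mul, sum_sub_distrib]
    simp
    left
    field_simp
  have h2 : ∀ S, fourier p S = if S = 0 then 0 else fourier f (S ᵥ* L) := fun S => by
    have e : ∀ w, ((p w : ℝ) : ℂ) * ZMod.stdAddChar (S ⬝ᵥ w) = ∑ x, (f x : ℂ) *
        ((if L *ᵥ x = w then ZMod.stdAddChar (S ⬝ᵥ w) else 0)
          - 1 / (r : ℂ) ^ m * ZMod.stdAddChar (S ⬝ᵥ w)) := fun w => by
      simp only [hp, Complex.ofReal_sum, sum_mul]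
      refine sum_congr rfl fun x _ => ?_
      split_ifs <;> (push_cast; ring)
    have e2 : ∑ w, (ZMod.stdAddChar (S ⬝ᵥ w) : ℂ) = if S = 0 then (r : ℂ) ^ m else 0 := by
      have := sum_stdAddChar_dotProduct S
      simp only [dotProduct_comm _ S, Fintype.card_fin] at this
      exact this
    simp only [fourier, e]
    rw [sum_comm]
    simp only [← mul_sum, sum_sub_distrib, e2]
    split_ifs with h
    · subst h
      simp [hrc]
    · refine sum_congr rfl fun x _ => ?_
      simp [dotProduct_mulVec]
  have h3 := parseval p
  rw [Fintype.card_fin] at h3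
  rw [h1]
  calc (∑ w, p w * B w) ^ 2 ≤ (∑ w, p w ^ 2) * ∑ w, B w ^ 2 := sum_mul_sq_le_sq_mul_sq _ _ _
    _ ≤ (∑ w, p w ^ 2) * ∑ w : Fin m → ZMod r, (1 : ℝ) := by
        gcongr with w
        exact (sq_le_one_iff_abs_le_one _).2 (hB w)
    _ = ∑ S, ‖fourier p S‖ ^ 2 := by rw [h3]; simp; ring
    _ = _ := by
        rw [sum_filter]
        refine sum_congr rfl fun S _ => ?_
        rw [h2]
        split_ifs <;> simp_all

end Level

/-! ### Averaging over a random hypermatching. -/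

section Matchings

open Matrix

theorem exists_perm_map_eq {β : Type*} [Fintype β] [DecidableEq β] {D D' : Finset β}
    (h : #D = #D') : ∃ σ : Equiv.Perm β, D.map σ.toEmbedding = D' := by
  let e : {x // x ∈ D} ≃ {x // x ∈ D'} := equivOfCardEq h
  refine ⟨e.extendSubtype, eq_of_subset_of_card_le (fun y hy => ?_) (by rw [card_map, h])⟩
  obtain ⟨x, hx, rfl⟩ := mem_map.1 hy
  exact e.extendSubtype_mem x hx

/-- The image of a fixed set under a uniformly random embedding is uniformly distributed. -/
theorem sum_embedding_map {α β : Type*} [Fintype α] [DecidableEq α] [Fintype β] [DecidableEq β]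
    (J : Finset α) (H : Finset β → ℝ) :
    ((Fintype.card β).choose #J : ℝ) * ∑ M : α ↪ β, H (J.map M) =
      Fintype.card (α ↪ β) * ∑ D ∈ powersetCard #J univ, H D := by
  set N : Finset β → ℕ := fun D => #{M : α ↪ β | J.map M = D} with hN
  -- Permutations of the target act on embeddings by composition, so the fibre size depends only on
  -- the cardinality of the image. Its value comes from testing with the constant 1.
  have hsymm : ∀ D D', #D = #D' → N D = N D' := fun D D' h => by
    obtain ⟨σ, rfl⟩ := exists_perm_map_eq h
    refine card_bij (fun M _ => M.trans σ.toEmbedding) ?_ ?_ ?_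
    · intro M hM
      simp only [mem_filter, mem_univ, true_and] at hM ⊢
      rw [← hM, Finset.map_map]
    · intro M _ M' _ h
      ext x
      simpa using DFunLike.congr_fun h x
    · intro M hM
      simp only [mem_filter, mem_univ, true_and] at hM
      refine ⟨M.trans σ.symm.toEmbedding, ?_, ?_⟩
      · simp only [mem_filter, mem_univ, true_and]
        rw [← Finset.map_map, hM, Finset.map_map]
        ext x
        simp
      · ext x
        simp
  have hmaps : ∀ M ∈ (univ : Finset (α ↪ β)), J.map M ∈ powersetCard #J univ := fun M _ =>
    mem_powersetCard.2 ⟨subset_univ _, card_map _⟩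
  have h1 : ∀ F : Finset β → ℝ, ∑ M : α ↪ β, F (J.map M) =
      ∑ D ∈ powersetCard #J univ, (N D : ℝ) * F D := fun F => by
    rw [← sum_fiberwise_of_maps_to hmaps]
    refine sum_congr rfl fun D _ => ?_
    rw [sum_congr rfl (fun M hM => by rw [(mem_filter.1 hM).2] :
      ∀ M ∈ univ.filter (fun M : α ↪ β => J.map M = D), F (J.map M) = F D), sum_const,
      nsmul_eq_mul]
  rcases (powersetCard #J (univ : Finset β)).eq_empty_or_nonempty with h0 | ⟨D₀, hD₀⟩
  · have h2 := h1 H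
    rw [h0, sum_empty] at h2
    rw [h2, h0, sum_empty, mul_zero, mul_zero]
  · have hc : ∀ D ∈ powersetCard #J (univ : Finset β), N D = N D₀ := fun D hD =>
      hsymm _ _ ((mem_powersetCard.1 hD).2.trans (mem_powersetCard.1 hD₀).2.symm)
    have h2 := h1 fun _ => 1
    have h3 := h1 H
    have h4 : ∀ F : Finset β → ℝ, ∑ D ∈ powersetCard #J univ, (N D : ℝ) * F D =
        N D₀ * ∑ D ∈ powersetCard #J univ, F D := fun F => by
      rw [mul_sum]
      exact sum_congr rfl fun D hD => by rw [hc D hD]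
    rw [h4] at h2 h3
    simp only [sum_const, card_univ, card_powersetCard, nsmul_eq_mul, mul_one] at h2
    rw [h3, h2]
    ring

variable {r t n m : ℕ}

theorem vecMul_incidence_apply (M : Hypermatching t n m) (S : Fin m → ZMod r) (i : Fin m)
    (j : Fin t) : (S ᵥ* incidence r M) (M (i, j)) = S i := by
  simp only [vecMul, dotProduct, incidence]
  rw [sum_eq_single i]
  · simp
  · intro i' _ hi'
    rw [if_neg, mul_zero]
    rintro ⟨j', hj'⟩
    exact hi' (Prod.ext_iff.1 (M.injective hj')).1
  · simp

theorem supp_vecMul_incidence (M : Hypermatching t n m) (S : Fin m → ZMod r) :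
    supp (S ᵥ* incidence r M) = (supp S ×ˢ univ).map M := by
  ext v
  simp only [supp, mem_filter, mem_univ, true_and, mem_map, mem_product, and_true, Prod.exists]
  constructor
  · intro h
    by_contra hv
    refine h ?_
    rw [vecMul, dotProduct]
    refine sum_eq_zero fun i _ => ?_
    by_cases hi : S i = 0
    · simp [hi]
    · rw [incidence, if_neg, mul_zero]
      rintro ⟨j, hj⟩
      exact hv ⟨i, j, hi, hj⟩
  · rintro ⟨i, j, hi, rfl⟩
    rwa [vecMul_incidence_apply]

theorem vecMul_incidence_injective (ht : 0 < t) (M : Hypermatching t n m) :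
    Function.Injective fun S : Fin m → ZMod r => S ᵥ* incidence r M := fun S S' h => by
  funext i
  rw [← vecMul_incidence_apply M S i ⟨0, ht⟩, ← vecMul_incidence_apply M S' i ⟨0, ht⟩]
  exact congrFun h _

variable [NeZero r]

/-- The vectors `S M` are constant on each hyperedge. That is forgotten here and every vector with
the same support is admitted, so that averaging over `M` only needs the law of a union of
hyperedges. -/
theorem sum_vecMul_incidence_le (ht : 0 < t) {G : (Fin n → ZMod r) → ℝ} (hG : ∀ V, 0 ≤ G V)
    (M : Hypermatching t n m) :
    ∑ S, G (S ᵥ* incidence r M) ≤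
      ∑ I : Finset (Fin m), ∑ V with supp V = (I ×ˢ univ).map M, G V := by
  rw [← sum_fiberwise univ supp]
  gcongr with I
  rw [← sum_image (g := fun S : Fin m → ZMod r => S ᵥ* incidence r M)
    fun S _ S' _ h => vecMul_incidence_injective ht M h]
  refine sum_le_sum_of_subset_of_nonneg (fun V hV => ?_) fun V _ _ => hG V
  obtain ⟨S, hS, rfl⟩ := mem_image.1 hV
  simp only [mem_filter, mem_univ, true_and] at hS ⊢
  rw [supp_vecMul_incidence, hS]

theorem sum_hypermatching_le (ht : 0 < t) (hmn : m * t ≤ n) {G : (Fin n → ZMod r) → ℝ}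
    (hG : ∀ V, 0 ≤ G V) :
    ∑ M : Hypermatching t n m, ∑ S, G (S ᵥ* incidence r M) ≤
      Fintype.card (Hypermatching t n m) *
        ∑ k ∈ range (m + 1), ((m.choose k : ℝ) / (n.choose (k * t) : ℝ)) * levelSum G (k * t) := by
  have hI : ∀ I : Finset (Fin m),
      ∑ M : Hypermatching t n m, ∑ V with supp V = (I ×ˢ univ).map M, G V =
      (fun k : ℕ => (Fintype.card (Hypermatching t n m) : ℝ) / (n.choose (k * t) : ℝ) *
        levelSum G (k * t)) #I := fun I => by
    have h := sum_embedding_map (α := Fin m × Fin t) (β := Fin n) (I ×ˢ univ)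
      fun D => ∑ V with supp V = D, G V
    rw [card_product, card_univ, Fintype.card_fin, Fintype.card_fin] at h
    have hpos : (0 : ℝ) < (n.choose (#I * t) : ℝ) := by
      have h1 : #I ≤ m := by simpa using card_le_univ I
      exact_mod_cast Nat.choose_pos ((Nat.mul_le_mul_right t h1).trans hmn)
    have h2 : ∑ D ∈ powersetCard (#I * t) (univ : Finset (Fin n)), ∑ V with supp V = D, G V =
        levelSum G (#I * t) := by
      have := sum_fiberwise_of_maps_to (s := univ.filter fun V : Fin n → ZMod r =>
        #(supp V) = #I * t) (t := powersetCard (#I * t) univ) (g := supp)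
        (fun V hV => mem_powersetCard.2 ⟨subset_univ _, (mem_filter.1 hV).2⟩) G
      rw [levelSum, ← this]
      refine sum_congr rfl fun D hD => sum_congr ?_ fun _ _ => rfl
      ext V
      simp only [mem_filter, mem_univ, true_and]
      constructor
      · rintro rfl; exact ⟨(mem_powersetCard.1 hD).2, rfl⟩
      · exact fun h => h.2
    rw [h2] at h
    simp only
    rw [div_mul_eq_mul_div, eq_div_iff hpos.ne', mul_comm, h]
  calc ∑ M : Hypermatching t n m, ∑ S, G (S ᵥ* incidence r M)
      ≤ ∑ M : Hypermatching t n m, ∑ I : Finset (Fin m),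
          ∑ V with supp V = (I ×ˢ univ).map M, G V :=
        sum_le_sum fun M _ => sum_vecMul_incidence_le ht hG M
    _ = _ := by
        rw [sum_comm, sum_congr rfl fun I _ => hI I, ← powerset_univ, sum_powerset_apply_card (fun k : ℕ =>
            (Fintype.card (Hypermatching t n m) : ℝ) / (n.choose (k * t) : ℝ) * levelSum G (k * t)),
          card_univ, Fintype.card_fin, mul_sum]
        refine sum_congr rfl fun k _ => ?_
        rw [nsmul_eq_mul]
        ring

end Matchings

/-! ### Binomial ratios. -/

section Binomials

theorem pow_mul_descFactorial_le {n d : ℕ} (hdn : d ≤ n) {j : ℕ} (hj : j ≤ d) :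
    n ^ j * d.descFactorial j ≤ n.descFactorial j * d ^ j := by
  induction j with
  | zero => simp
  | succ j ih =>
    have h1 : n * (d - j) ≤ (n - j) * d := by
      zify [(by omega : j ≤ d), (by omega : j ≤ n)]
      have : (j : ℤ) * d ≤ j * n := by gcongr
      linarith
    rw [Nat.descFactorial_succ, Nat.descFactorial_succ]
    calc n ^ (j + 1) * ((d - j) * d.descFactorial j)
        = (n ^ j * d.descFactorial j) * (n * (d - j)) := by ring
      _ ≤ (n.descFactorial j * d ^ j) * ((n - j) * d) := Nat.mul_le_mul (ih (by omega)) h1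
      _ = _ := by ring

theorem pow_le_choose_mul_pow {n d : ℕ} (hdn : d ≤ n) : n ^ d ≤ n.choose d * d ^ d := by
  have h := pow_mul_descFactorial_le hdn le_rfl
  rw [Nat.descFactorial_self, Nat.descFactorial_eq_factorial_mul_choose] at h
  refine Nat.le_of_mul_le_mul_right (c := d.factorial) ?_ d.factorial_pos
  linarith

theorem choose_ratio_le {m n t k : ℕ} (hn : 0 < n) (hk : k * t ≤ n) :
    (m.choose k : ℝ) / (n.choose (k * t) : ℝ) ≤ (m * ((k * t : ℝ) / n) ^ t) ^ k := by
  have h1 : (m.choose k : ℝ) ≤ (m : ℝ) ^ k := by exact_mod_cast Nat.choose_le_pow m k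
  have h2 : (n : ℝ) ^ (k * t) ≤ n.choose (k * t) * (k * t : ℝ) ^ (k * t) := by
    exact_mod_cast pow_le_choose_mul_pow hk
  have h3 : (0 : ℝ) < n.choose (k * t) := by exact_mod_cast Nat.choose_pos hk
  have h4 : (0 : ℝ) < n := by exact_mod_cast hn
  rw [mul_pow, ← pow_mul, mul_comm t k, div_pow, div_le_iff₀ h3]
  calc (m.choose k : ℝ) ≤ (m : ℝ) ^ k * 1 := by rw [mul_one]; exact h1
    _ ≤ (m : ℝ) ^ k * ((n.choose (k * t) * (k * t : ℝ) ^ (k * t)) / (n : ℝ) ^ (k * t)) := by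
        gcongr
        rw [le_div_iff₀ (by positivity), one_mul]
        exact h2
    _ = _ := by ring

theorem choose_le_choose_of_le_half {n a b : ℕ} (hab : a ≤ b) (hb : 2 * b ≤ n) :
    n.choose a ≤ n.choose b := by
  induction b, hab using Nat.le_induction with
  | base => rfl
  | succ b hab ih =>
    exact (ih (by omega)).trans (Nat.choose_le_succ_of_lt_half_left (by omega))

/-- Of the `t` steps from `k * t` to `(k + 1) * t`, the first `t - 1` do not decrease the binomial
below the middle. The last step alone beats the factor (m-k)/(k+1). -/
theorem choose_succ_mul_choose_le {m n t k : ℕ} (ht : 0 < t) (hk : k < m) (hmn : 2 * (m * t) ≤ n) :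
    m.choose (k + 1) * n.choose (k * t) ≤ m.choose k * n.choose ((k + 1) * t) := by
  obtain ⟨s, rfl⟩ : ∃ s, t = s + 1 := ⟨t - 1, by omega⟩
  have hkm : (k + 1) * (s + 1) ≤ m * (s + 1) := Nat.mul_le_mul_right _ hk
  have e1 : (k + 1) * (s + 1) = k * (s + 1) + s + 1 := by ring
  have h1 := Nat.choose_succ_right_eq m k
  have h2 := Nat.choose_succ_right_eq n (k * (s + 1) + s)
  have h3 : n.choose (k * (s + 1)) ≤ n.choose (k * (s + 1) + s) :=
    choose_le_choose_of_le_half (by omega) (by omega)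
  have h4 : (m - k) * (s + 1) ≤ n - (k * (s + 1) + s) := by
    rw [Nat.sub_mul]; omega
  rw [e1]
  refine Nat.le_of_mul_le_mul_right (c := (k + 1) * (s + 1)) ?_ (by positivity)
  calc m.choose (k + 1) * n.choose (k * (s + 1)) * ((k + 1) * (s + 1))
      = (m.choose (k + 1) * (k + 1)) * n.choose (k * (s + 1)) * (s + 1) := by ring
    _ = m.choose k * n.choose (k * (s + 1)) * ((m - k) * (s + 1)) := by rw [h1]; ring
    _ ≤ m.choose k * n.choose (k * (s + 1) + s) * (n - (k * (s + 1) + s)) := by gcongr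
    _ = m.choose k * (n.choose (k * (s + 1) + s + 1) * (k * (s + 1) + s + 1)) := by
        rw [h2]; ring
    _ = _ := by rw [← e1]; ring

theorem choose_ratio_antitone {m n t a b : ℕ} (ht : 0 < t) (hmn : 2 * (m * t) ≤ n) (hab : a ≤ b)
    (hb : b ≤ m) :
    (m.choose b : ℝ) / (n.choose (b * t) : ℝ) ≤ (m.choose a : ℝ) / (n.choose (a * t) : ℝ) := by
  induction b, hab using Nat.le_induction with
  | base => rfl
  | succ b hab ih =>
    refine le_trans ?_ (ih (by omega))
    have h1 : ∀ j ≤ m, (0 : ℝ) < n.choose (j * t) := fun j hj => by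
      have := Nat.mul_le_mul_right t hj
      exact_mod_cast Nat.choose_pos (by omega : j * t ≤ n)
    rw [div_le_div_iff₀ (h1 _ hb) (h1 _ (by omega))]
    exact_mod_cast choose_succ_mul_choose_le ht (by omega) hmn

end Binomials

/-! ### Summing the weighted levels. -/

section Weighted

variable {r : ℕ} [NeZero r] {t n m c : ℕ}

theorem low_term_le (hr : 2 ≤ r) (ht : 0 < t) (hn : 0 < n) (hmn : m * t ≤ n) {k : ℕ} (hk : 0 < k)
    (hkc : k ≤ c) (hkm : k ≤ m) {ε : ℝ} (hε : 0 < ε) (hε1 : ε ≤ 1) (A : Finset (Fin n → ZMod r))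
    (hA : ε ≤ 2 ^ c * (#A / (r : ℝ) ^ n)) :
    (m.choose k : ℝ) / (n.choose (k * t) : ℝ) * levelSum (energy (ind A)) (k * t) ≤
      (m * (48 * r * c * t / n : ℝ) ^ t) ^ k * ((#A / (r : ℝ) ^ n) ^ 2 / ε) := by
  have hn0 : (0 : ℝ) < n := by exact_mod_cast hn
  have hk0 : (0 : ℝ) < k := by exact_mod_cast hk
  have hkt : 0 < k * t := by positivity
  have hlt : c < k * t * (c / (k * t) + 1) := Nat.lt_mul_div_succ c hkt
  -- The exponent c/(kt) + 2 suffices for 2^c ≤ 2^(ds) and is at most 3c/k. The k in kt/n then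
  -- cancels, leaving 48 = 16 · 3.
  have h1 := levelSum_energy_le (k := c / (k * t)) (d := k * t) (c := c) hr
    (by nlinarith) hε hε1 A hA
  have h2 := choose_ratio_le (m := m) hn ((Nat.mul_le_mul_right t hkm).trans hmn)
  have h3 : ((c / (k * t) : ℕ) : ℝ) + 2 ≤ 3 * c / k := by
    rw [le_div_iff₀ hk0]
    have : (c / (k * t) + 2) * k ≤ 3 * c := by
      have e1 : c / (k * t) * k ≤ c :=
        calc c / (k * t) * k ≤ c / (k * t) * (k * t) := by
              gcongr; exact Nat.le_mul_of_pos_right k ht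
          _ ≤ c := Nat.div_mul_le_self _ _
      nlinarith
    exact_mod_cast this
  calc _ ≤ (m * ((k * t : ℝ) / n) ^ t) ^ k *
        ((16 * ((c / (k * t) : ℕ) + 2) * r) ^ (k * t) * (#A / (r : ℝ) ^ n) ^ 2 / ε) := by
        gcongr
        exact levelSum_nonneg (energy_nonneg _) _
    _ ≤ (m * ((k * t : ℝ) / n) ^ t) ^ k *
        ((16 * (3 * c / k) * r) ^ (k * t) * (#A / (r : ℝ) ^ n) ^ 2 / ε) := by gcongr
    _ = (m * (((k * t : ℝ) / n) * (16 * (3 * c / k) * r)) ^ t) ^ k *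
        ((#A / (r : ℝ) ^ n) ^ 2 / ε) := by
        have e : ∀ a b x : ℝ, (m * a ^ t) ^ k * (b ^ (k * t) * x / ε) =
            (m * (a * b) ^ t) ^ k * (x / ε) := fun a b x => by ring
        exact e _ _ _
    _ = _ := by
        congr 4
        field_simp
        ring

theorem high_terms_le (hr : 2 ≤ r) (ht : 0 < t) (hn : 0 < n) (hmn : 2 * (m * t) ≤ n)
    (hc : 0 < c) {ε : ℝ} (hε : 0 < ε) (A : Finset (Fin n → ZMod r))
    (hA : ε ≤ 2 ^ c * (#A / (r : ℝ) ^ n)) :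
    ∑ k ∈ range (m + 1) with ¬ k ≤ c,
      (m.choose k : ℝ) / (n.choose (k * t) : ℝ) * levelSum (energy (ind A)) (k * t) ≤
      (m * (48 * r * c * t / n : ℝ) ^ t) ^ (c + 1) * ((#A / (r : ℝ) ^ n) ^ 2 / ε) := by
  have hn0 : (0 : ℝ) < n := by exact_mod_cast hn
  have hr0 : (2 : ℝ) ≤ r := by exact_mod_cast hr
  have hc1 : (1 : ℝ) ≤ c := by exact_mod_cast hc
  have ht1 : (0 : ℝ) < t := by exact_mod_cast ht
  set μ : ℝ := #A / (r : ℝ) ^ n with hμ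
  have hμ0 : 0 ≤ μ := by positivity
  by_cases hcm : c + 1 ≤ m
  swap
  · rw [sum_eq_zero fun k hk => by simp at hk; omega]
    positivity
  have h1 : ((c + 1) * t : ℕ) ≤ n := by
    have := Nat.mul_le_mul_right t hcm
    omega
  have h2 := choose_ratio_le (m := m) hn h1
  have h3 : ∑ k ∈ range (m + 1) with ¬ k ≤ c, levelSum (energy (ind A)) (k * t) ≤ μ := by
    refine (sum_levelSum_le (energy_nonneg _) ht _).trans ?_
    rw [sum_energy]
    nlinarith [sq_nonneg μ]
  -- The lower bound on the density converts μ into μ². The spare 2^c is absorbed by doubling the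
  -- base of the power.
  have h4 : μ ≤ 2 ^ c * (μ ^ 2 / ε) := by
    rw [mul_div_assoc', le_div_iff₀ hε]
    nlinarith
  have h5 : (2 : ℝ) ^ c ≤ (2 ^ t) ^ (c + 1) := by
    rw [← pow_mul]
    exact pow_le_pow_right₀ (by norm_num) (by nlinarith)
  have h6 : 2 * (((c : ℝ) + 1) * t) ≤ 48 * r * c * t := by
    rw [← mul_assoc]
    refine mul_le_mul_of_nonneg_right ?_ ht1.le
    nlinarith
  calc _ ≤ ∑ k ∈ range (m + 1) with ¬ k ≤ c,
        (m.choose (c + 1) : ℝ) / (n.choose ((c + 1) * t) : ℝ) *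
          levelSum (energy (ind A)) (k * t) := by
        refine sum_le_sum fun k hk => ?_
        simp only [mem_filter, mem_range] at hk
        exact mul_le_mul_of_nonneg_right (choose_ratio_antitone ht hmn (by omega) (by omega))
          (levelSum_nonneg (energy_nonneg _) _)
    _ ≤ (m * (((c + 1 : ℕ) * t : ℝ) / n) ^ t) ^ (c + 1) * (2 ^ c * (μ ^ 2 / ε)) := by
        rw [← mul_sum]
        exact mul_le_mul h2 (h3.trans h4)
          (sum_nonneg fun k _ => levelSum_nonneg (energy_nonneg _) _) (by positivity)
    _ ≤ (m * (((c + 1 : ℕ) * t : ℝ) / n) ^ t) ^ (c + 1) * ((2 ^ t) ^ (c + 1) * (μ ^ 2 / ε)) := by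
        gcongr
    _ = (m * (2 * (((c + 1 : ℕ) * t : ℝ) / n)) ^ t) ^ (c + 1) * (μ ^ 2 / ε) := by
        rw [mul_pow 2, ← mul_assoc, ← mul_pow]; ring
    _ ≤ _ := by
        gcongr
        rw [mul_div_assoc']
        refine div_le_div_of_nonneg_right ?_ hn0.le
        push_cast
        exact h6

theorem sum_choose_ratio_mul_levelSum_le (hr : 2 ≤ r) (ht : 0 < t) (hn : 0 < n)
    (hmn : 2 * (m * t) ≤ n) (hc : 0 < c) {ε : ℝ} (hε : 0 < ε) (hε1 : ε ≤ 1)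
    (hη : m * (48 * r * c * t / n : ℝ) ^ t ≤ 1 / 2) (A : Finset (Fin n → ZMod r))
    (hA : ε ≤ 2 ^ c * (#A / (r : ℝ) ^ n)) :
    ∑ k ∈ range (m + 1),
      (m.choose k : ℝ) / (n.choose (k * t) : ℝ) * levelSum (energy (ind A)) (k * t) ≤
      2 * (m * (48 * r * c * t / n : ℝ) ^ t) * ((#A / (r : ℝ) ^ n) ^ 2 / ε) := by
  have hhigh := high_terms_le hr ht hn hmn hc hε A hA
  set η : ℝ := m * (48 * r * c * t / n : ℝ) ^ t with hηd
  have hη0 : 0 ≤ η := by positivity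
  set Q : ℝ := (#A / (r : ℝ) ^ n) ^ 2 / ε with hQ
  have hQ0 : 0 ≤ Q := by positivity
  have hlow : ∑ k ∈ range (m + 1) with k ≤ c,
      (m.choose k : ℝ) / (n.choose (k * t) : ℝ) * levelSum (energy (ind A)) (k * t) ≤
      ∑ k ∈ range (c + 1), (if k = 0 then 0 else η ^ k * Q) := by
    refine le_trans (sum_le_sum fun k hk => ?_)
      (sum_le_sum_of_subset_of_nonneg (s := (range (m + 1)).filter (· ≤ c)) (fun k hk => ?_)
        fun k _ _ => ?_)
    · simp only [mem_filter, mem_range] at hk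
      split_ifs with h0
      · rw [h0, zero_mul, levelSum_energy_zero, mul_zero]
      · exact low_term_le hr ht hn (by omega) (Nat.pos_of_ne_zero h0) hk.2 (by omega) hε hε1 A hA
    · simp only [mem_filter, mem_range] at hk ⊢
      omega
    · split_ifs <;> positivity
  rw [← sum_filter_add_sum_filter_not _ (· ≤ c)]
  calc _ ≤ (∑ k ∈ range (c + 1), (if k = 0 then 0 else η ^ k * Q)) + η ^ (c + 1) * Q :=
        add_le_add hlow hhigh
    _ = η * (∑ k ∈ range (c + 1), η ^ k) * Q := by
        rw [sum_range_succ', sum_range_succ (fun k => η ^ k)]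
        simp only [Nat.succ_ne_zero, if_false, if_true, pow_succ, add_zero]
        rw [mul_add, mul_sum, add_mul, sum_mul]
        congr 1
        · exact sum_congr rfl fun _ _ => by ring
        · ring
    _ ≤ η * 2 * Q := by
        gcongr
        calc ∑ k ∈ range (c + 1), η ^ k ≤ ∑ k ∈ range (c + 1), (1 / 2 : ℝ) ^ k := by gcongr
          _ ≤ 2 := sum_geometric_two_le _
    _ = _ := by ring

end Weighted

/-! ### From Fourier weight to success probability. -/

section Protocols

open Matrix

variable {r t n m c : ℕ}

/-- Bob's answer as a real number. -/
def answer (D : DetProtocol r t n m c) (a : Fin c → Bool) (M : Hypermatching t n m)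
    (w : Fin m → ZMod r) : ℝ := if D.bob a M w = true then 1 else 0

theorem answer_nonneg (D : DetProtocol r t n m c) (a M w) : 0 ≤ answer D a M w := by
  unfold answer; split_ifs <;> norm_num

theorem answer_le_one (D : DetProtocol r t n m c) (a M w) : answer D a M w ≤ 1 := by
  unfold answer; split_ifs <;> norm_num

theorem vecMul_incidence_ne_zero (ht : 0 < t) (M : Hypermatching t n m) {S : Fin m → ZMod r}
    (hS : S ≠ 0) : S ᵥ* incidence r M ≠ 0 := fun h =>
  hS (vecMul_incidence_injective ht M (by simpa using h))

variable [NeZero r]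

/-- The inputs on which Alice sends the message `a`. -/
def messageClass (D : DetProtocol r t n m c) (a : Fin c → Bool) : Finset (Fin n → ZMod r) :=
  univ.filter fun x => D.alice x = a

/-- The unnormalised advantage gained on the message `a` and the hypermatching `M`. -/
noncomputable def classBias (D : DetProtocol r t n m c) (a : Fin c → Bool)
    (M : Hypermatching t n m) : ℝ :=
  ∑ x, ind (messageClass D a) x *
    (answer D a M (incidence r M *ᵥ x) - (∑ w, answer D a M w) / (r : ℝ) ^ m)

theorem card_hypermatching_pos (hmn : m * t ≤ n) :
    (0 : ℝ) < Fintype.card (Hypermatching t n m) := by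
  have : Nonempty (Hypermatching t n m) :=
    Function.Embedding.nonempty_of_card_le (by simpa using hmn)
  exact_mod_cast Fintype.card_pos

theorem successProb_eq (hmn : m * t ≤ n) (D : DetProtocol r t n m c) :
    D.successProb = 1 / 2 + 1 / 2 * ∑ a, (∑ M, classBias D a M) /
      (Fintype.card (Hypermatching t n m) * (r : ℝ) ^ n) := by
  have hH := card_hypermatching_pos hmn
  have hr0 : (r : ℝ) ≠ 0 := by exact_mod_cast NeZero.ne r
  have hfalse : ∀ a M w, (if D.bob a M w = false then (1 : ℝ) else 0) = 1 - answer D a M w :=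
    fun a M w => by unfold answer; cases D.bob a M w <;> simp
  have h1 : ∀ x M, (1 / 2 : ℝ) * (if D.bob (D.alice x) M (incidence r M *ᵥ x) = true
        then 1 else 0) + (1 / 2 : ℝ) * 𝔼 w : Fin m → ZMod r,
          (if D.bob (D.alice x) M w = false then (1 : ℝ) else 0) =
      1 / 2 + 1 / 2 * ∑ a, ind (messageClass D a) x *
        (answer D a M (incidence r M *ᵥ x) - (∑ w, answer D a M w) / (r : ℝ) ^ m) := fun x M => by
    rw [sum_eq_single (D.alice x)]
    · simp only [hfalse, Fintype.expect_eq_sum_div_card, sum_sub_distrib]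
      simp [ind, messageClass, answer, sub_div, hr0]
      split_ifs <;> ring
    · intro a _ ha
      simp [ind, messageClass, ha.symm]
    · simp
  unfold DetProtocol.successProb
  simp only [h1]
  simp only [Fintype.expect_eq_sum_div_card]
  simp only [classBias, sum_add_distrib, ← mul_sum, add_div, ← sum_div]
  simp only [sum_const, card_univ, Fintype.card_pi, ZMod.card, prod_const, Fintype.card_fin,
    nsmul_eq_mul, Nat.cast_pow]
  have h2 : ∀ F : (Fin c → Bool) → Hypermatching t n m → (Fin n → ZMod r) → ℝ,
      ∑ x, ∑ M, ∑ a, F a M x = ∑ a, ∑ M, ∑ x, F a M x := fun F => by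
    rw [sum_comm]
    rw [sum_congr rfl fun M _ => sum_comm]
    rw [sum_comm]
  rw [h2]
  field_simp
  simp only [mul_comm ((r : ℝ) ^ m)]

theorem sum_card_messageClass (D : DetProtocol r t n m c) :
    ∑ a, (#(messageClass D a) : ℝ) = (r : ℝ) ^ n := by
  have := card_eq_sum_card_fiberwise (f := D.alice) (s := univ) (t := univ) (by simp)
  rw [card_univ, Fintype.card_pi] at this
  simp only [ZMod.card, prod_const, card_univ, Fintype.card_fin] at this
  unfold messageClass
  exact_mod_cast this.symm

theorem classBias_le_card (D : DetProtocol r t n m c) (a : Fin c → Bool)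
    (M : Hypermatching t n m) : classBias D a M ≤ #(messageClass D a) := by
  rw [← sum_ind]
  refine sum_le_sum fun x _ => mul_le_of_le_one_right ?_ ?_
  · unfold ind; split_ifs <;> norm_num
  · have h1 := answer_le_one D a M (incidence r M *ᵥ x)
    have h2 : 0 ≤ (∑ w, answer D a M w) / (r : ℝ) ^ m :=
      div_nonneg (sum_nonneg fun w _ => answer_nonneg D a M w) (by positivity)
    linarith

theorem sq_classBias_le (ht : 0 < t) (D : DetProtocol r t n m c) (a : Fin c → Bool)
    (M : Hypermatching t n m) :
    (classBias D a M / (r : ℝ) ^ n) ^ 2 ≤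
      ∑ S, energy (ind (messageClass D a)) (S ᵥ* incidence r M) := by
  have h := sq_sum_mul_sub_mean_le (ind (messageClass D a)) (incidence r M) (answer D a M)
    fun w => abs_le.2 ⟨by linarith [answer_nonneg D a M w], answer_le_one D a M w⟩
  rw [div_pow]
  calc _ ≤ (∑ S with S ≠ 0, ‖fourier (ind (messageClass D a)) (S ᵥ* incidence r M)‖ ^ 2) /
        ((r : ℝ) ^ n) ^ 2 := by gcongr; exact h
    _ = ∑ S with S ≠ 0, energy (ind (messageClass D a)) (S ᵥ* incidence r M) := by
        rw [sum_div]
        refine sum_congr rfl fun S hS => ?_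
        rw [energy, if_neg (vecMul_incidence_ne_zero ht M (mem_filter.1 hS).2)]
    _ ≤ _ := sum_le_sum_of_subset_of_nonneg (subset_univ _) fun S _ _ => energy_nonneg _ _

theorem sq_sum_classBias_le (ht : 0 < t) (hmn : m * t ≤ n) (D : DetProtocol r t n m c)
    (a : Fin c → Bool) :
    ((∑ M, classBias D a M) / (Fintype.card (Hypermatching t n m) * (r : ℝ) ^ n)) ^ 2 ≤
      ∑ k ∈ range (m + 1), (m.choose k : ℝ) / (n.choose (k * t) : ℝ) *
        levelSum (energy (ind (messageClass D a))) (k * t) := by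
  have hH := card_hypermatching_pos hmn
  set H : ℝ := ((Fintype.card (Hypermatching t n m) : ℕ) : ℝ) with hHd
  have h1 := sum_hypermatching_le ht hmn (energy_nonneg (ind (messageClass D a)))
  have h2 := sq_sum_le_card_mul_sum_sq (s := univ) (f := fun M : Hypermatching t n m =>
    classBias D a M / (r : ℝ) ^ n)
  rw [card_univ, ← sum_div] at h2
  have h3 := sum_le_sum fun M (_ : M ∈ (univ : Finset (Hypermatching t n m))) =>
    sq_classBias_le ht D a M
  rw [mul_comm H, ← div_div, div_pow, div_le_iff₀ (by positivity)]
  refine h2.trans ?_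
  calc _ ≤ H * (H * _) := mul_le_mul_of_nonneg_left (h3.trans h1) hH.le
    _ = _ := by ring

theorem successProb_le (ht : 0 < t) (hmn : m * t ≤ n) (D : DetProtocol r t n m c) {ε δ : ℝ}
    (hε : 0 < ε) (hδ : 0 ≤ δ)
    (h : ∀ a, ε ≤ 2 ^ c * (#(messageClass D a) / (r : ℝ) ^ n) →
      ∑ k ∈ range (m + 1), (m.choose k : ℝ) / (n.choose (k * t) : ℝ) *
        levelSum (energy (ind (messageClass D a))) (k * t) ≤
      (δ * (#(messageClass D a) / (r : ℝ) ^ n)) ^ 2) :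
    D.successProb ≤ 1 / 2 + (ε + δ) / 2 := by
  have hr0 : (0 : ℝ) < r := by exact_mod_cast Nat.pos_of_ne_zero (NeZero.ne r)
  have hH := card_hypermatching_pos hmn
  rw [successProb_eq hmn]
  have hterm : ∀ a, (∑ M, classBias D a M) /
      (Fintype.card (Hypermatching t n m) * (r : ℝ) ^ n) ≤
      ε / 2 ^ c + δ * (#(messageClass D a) / (r : ℝ) ^ n) := fun a => by
    -- Light messages are bounded trivially by their density. There are 2^c messages, so in total
    -- they contribute at most ε.
    by_cases ha : ε ≤ 2 ^ c * (#(messageClass D a) / (r : ℝ) ^ n)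
    · have h1 := abs_le_of_sq_le_sq ((sq_sum_classBias_le ht hmn D a).trans (h a ha))
        (by positivity)
      have : 0 ≤ ε / 2 ^ c := by positivity
      linarith [(abs_le.1 h1).2]
    · have h1 : ∑ M, classBias D a M ≤
          Fintype.card (Hypermatching t n m) * #(messageClass D a) := by
        refine (sum_le_sum fun M _ => classBias_le_card D a M).trans ?_
        simp
      have h2 : (∑ M, classBias D a M) / (Fintype.card (Hypermatching t n m) * (r : ℝ) ^ n) ≤
          #(messageClass D a) / (r : ℝ) ^ n := by
        rw [div_le_div_iff₀ (by positivity) (by positivity)]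
        nlinarith [mul_le_mul_of_nonneg_right h1 (by positivity : 0 ≤ (r : ℝ) ^ n)]
      have h3 : #(messageClass D a) / (r : ℝ) ^ n ≤ ε / 2 ^ c := by
        rw [le_div_iff₀ (by positivity)]
        linarith
      have : 0 ≤ δ * (#(messageClass D a) / (r : ℝ) ^ n) := by positivity
      linarith
  have hsum := sum_le_sum fun a (_ : a ∈ (univ : Finset (Fin c → Bool))) => hterm a
  rw [sum_add_distrib, ← mul_sum, ← sum_div univ (fun a => (#(messageClass D a) : ℝ)),
    sum_card_messageClass, div_self (by positivity)] at hsum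
  simp only [sum_const, card_univ, Fintype.card_pi, Fintype.card_bool, prod_const,
    Fintype.card_fin, nsmul_eq_mul, Nat.cast_pow, Nat.cast_ofNat] at hsum
  rw [mul_div_cancel₀ _ (by positivity)] at hsum
  linarith

theorem successProb_lt (hr : 2 ≤ r) (ht : 0 < t) (hn : 0 < n) (hmn : 2 * (m * t) ≤ n) {ε : ℝ}
    (hε : 0 < ε) (hε1 : ε ≤ 1)
    (hη : m * (48 * r * c * t / n : ℝ) ^ t ≤ ε ^ 3 / 8) (D : DetProtocol r t n m c) :
    D.successProb < 1 / 2 + ε := by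
  have hε3 : ε ^ 3 ≤ 1 := pow_le_one₀ hε.le hε1
  have hr0 : (0 : ℝ) < r := by exact_mod_cast Nat.pos_of_ne_zero (NeZero.ne r)
  have h := successProb_le ht (by omega) D hε (δ := ε / 2) (by positivity) fun a ha => by
    -- With no communication there is one class, the whole space, and all nontrivial coefficients
    -- vanish. The tail estimate for k > c needs `c` positive.
    rcases Nat.eq_zero_or_pos c with rfl | hc
    · have hA : messageClass D a = univ := by
        ext x; simp [messageClass, Subsingleton.elim (D.alice x) a]
      have h1 : ∑ V, energy (ind (messageClass D a)) V = 0 := by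
        rw [sum_energy, hA, card_univ, Fintype.card_pi]
        simp only [ZMod.card, prod_const, card_univ, Fintype.card_fin, Nat.cast_pow]
        rw [div_self (by positivity)]
        norm_num
      have h2 : ∀ V, energy (ind (messageClass D a)) V = 0 := fun V =>
        (sum_eq_zero_iff_of_nonneg fun V _ => energy_nonneg _ V).1 h1 V (mem_univ V)
      rw [sum_eq_zero fun k _ => by rw [levelSum, sum_eq_zero fun V _ => h2 V, mul_zero]]
      positivity
    · refine (sum_choose_ratio_mul_levelSum_le hr ht hn hmn hc hε hε1 (by linarith) _ ha).trans ?_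
      calc _ ≤ 2 * (ε ^ 3 / 8) * ((#(messageClass D a) / (r : ℝ) ^ n) ^ 2 / ε) := by gcongr
        _ = _ := by field_simp; ring
  linarith

theorem successProb_nonneg (D : DetProtocol r t n m c) : 0 ≤ D.successProb := by
  unfold DetProtocol.successProb
  refine expect_nonneg fun x _ => expect_nonneg fun M _ => add_nonneg ?_
    (mul_nonneg (by norm_num) (expect_nonneg fun w _ => ?_)) <;> split_ifs <;> norm_num

theorem successProb_le_one (hmn : m * t ≤ n) (D : DetProtocol r t n m c) :
    D.successProb ≤ 1 := by
  have : Nonempty (Hypermatching t n m) :=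
    Function.Embedding.nonempty_of_card_le (by simpa using hmn)
  unfold DetProtocol.successProb
  refine expect_le univ_nonempty fun x _ => expect_le univ_nonempty fun M _ => ?_
  have h : (𝔼 w : Fin m → ZMod r, if D.bob (D.alice x) M w = false then (1 : ℝ) else 0) ≤ 1 :=
    expect_le univ_nonempty fun w _ => by split_ifs <;> norm_num
  split_ifs <;> linarith

/-- Averaging: some deterministic protocol does at least as well as the mixture. A point of the
support makes the comparison of sums strict. -/
theorem Protocol.exists_le_successProb (P : Protocol r t n m c) {s : ℝ}
    (hs : s ≤ Protocol.successProb P) (hmn : m * t ≤ n) :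
    ∃ D : DetProtocol r t n m c, s ≤ D.successProb := by
  by_contra! hlt
  have hP : HasSum (fun D => (P D).toReal) 1 := by
    have := P.tsum_coe
    have h := ENNReal.hasSum_toReal (f := fun D => P D) (by rw [this]; simp)
    rwa [← ENNReal.tsum_toReal_eq P.apply_ne_top, this, ENNReal.toReal_one] at h
  have hsum : Summable fun D => (P D).toReal * D.successProb :=
    hP.summable.of_nonneg_of_le (fun D => mul_nonneg ENNReal.toReal_nonneg (successProb_nonneg D))
      fun D => mul_le_of_le_one_right ENNReal.toReal_nonneg (successProb_le_one hmn D)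
  obtain ⟨D₀, hD₀⟩ := P.support_nonempty
  have hpos : 0 < (P D₀).toReal := ENNReal.toReal_pos ((P.mem_support_iff _).1 hD₀) (P.apply_ne_top _)
  have h3 : Protocol.successProb P < s := by
    have h4 := hP.mul_right s
    rw [one_mul] at h4
    rw [← h4.tsum_eq]
    exact Summable.tsum_lt_tsum (i := D₀)
      (fun D => mul_le_mul_of_nonneg_left (hlt D).le ENNReal.toReal_nonneg)
      (mul_lt_mul_of_pos_left (hlt D₀) hpos) hsum h4.summable
  linarith

end Protocols

/-! ### Solving for the communication cost. -/

/-- The arithmetic that turns a small communication cost into a small Fourier sum. -/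
theorem fourier_parameter_le {r t n m c : ℕ} {α ε : ℝ} (hr : 0 < r) (ht : 2 ≤ t) (hn : 0 < n)
    (hα : 0 < α) (hm : (m : ℝ) = α * n / t) (hε : 0 < ε) (hε2 : ε ≤ 1 / 2)
    (hc : (c : ℝ) < 1 / 96 * ((r : ℝ)⁻¹ * (ε ^ 4 / α) ^ (1 / (t : ℝ)) *
      ((n : ℝ) / t) ^ (1 - 1 / (t : ℝ)))) :
    m * (48 * r * c * t / n : ℝ) ^ t ≤ ε ^ 3 / 8 := by
  have hr0 : (0 : ℝ) < r := by exact_mod_cast hr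
  have ht0 : (0 : ℝ) < t := by exact_mod_cast (by omega : 0 < t)
  have hn0 : (0 : ℝ) < n := by exact_mod_cast hn
  set b : ℝ := n / t with hb
  have hb0 : 0 < b := by positivity
  set y : ℝ := (ε ^ 4 / α) ^ (1 / (t : ℝ)) * b ^ (1 - 1 / (t : ℝ)) with hy
  have hy0 : 0 ≤ y := by positivity
  have h1 : 48 * (r : ℝ) * c ≤ 1 / 2 * y := by
    have : (r : ℝ) * c ≤ r * (1 / 96 * ((r : ℝ)⁻¹ * y)) := by
      rw [hy, ← mul_assoc (r : ℝ)⁻¹]; gcongr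
    rw [show (r : ℝ) * (1 / 96 * ((r : ℝ)⁻¹ * y)) = 1 / 96 * y by field_simp] at this
    linarith
  have h2 : b * y ^ t = ε ^ 4 / α * b ^ t := by
    have e1 : ((ε ^ 4 / α) ^ (1 / (t : ℝ))) ^ t = ε ^ 4 / α := by
      rw [one_div, Real.rpow_inv_natCast_pow (by positivity) (by omega)]
    have e2 : b * (b ^ (1 - 1 / (t : ℝ))) ^ t = b ^ t := by
      rw [← Real.rpow_natCast, ← Real.rpow_mul hb0.le, sub_mul, one_mul,
        one_div_mul_cancel ht0.ne', Real.rpow_sub_one hb0.ne', Real.rpow_natCast]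
      field_simp
    rw [hy, mul_pow, e1, mul_left_comm, e2]
  have h3 : (m : ℝ) = α * b := by rw [hm, hb]; ring
  have h4 : (48 * r * c * t / n : ℝ) = 48 * r * c / b := by rw [hb]; field_simp
  rw [h3, h4]
  calc α * b * (48 * r * c / b) ^ t ≤ α * b * (1 / 2 * y / b) ^ t := by gcongr
    _ = α * (1 / 2) ^ t * (b * y ^ t) / b ^ t := by rw [div_pow, mul_pow]; ring
    _ = (1 / 2) ^ t * ε ^ 4 := by rw [h2]; field_simp
    -- The constant 1/96 is half of 1/48; the spare 2^(-t) ≤ 1/4 and ε ≤ 1/2 bring ε⁴ below ε³/8.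
    _ ≤ (1 / 2) ^ 2 * ε ^ 4 := by
        gcongr ?_ * _
        exact pow_le_pow_of_le_one (by norm_num) (by norm_num) ht
    _ = ε ^ 3 * (ε / 4) := by ring
    _ ≤ ε ^ 3 * (1 / 8) := mul_le_mul_of_nonneg_left (by linarith) (by positivity)
    _ = _ := by ring

end HiddenHypermatching

theorem mainTheorem6 :
    ∃ γ : ℝ, 0 < γ ∧
      ∀ (r t n m c : ℕ) [NeZero r] (α ε : ℝ),
        2 ≤ r → 2 ≤ t → t ∣ n → 0 < α → α ≤ 1 / 2 → (m : ℝ) = α * (n : ℝ) / (t : ℝ) → 0 < ε →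
        ∀ P : HiddenHypermatching.Protocol r t n m c,
          HiddenHypermatching.Protocol.AchievesAdvantage P ε →
          γ * ((r : ℝ)⁻¹ * (ε ^ 4 / α) ^ (1 / (t : ℝ)) *
            ((n : ℝ) / (t : ℝ)) ^ (1 - 1 / (t : ℝ))) ≤ (c : ℝ) := by
  refine ⟨1 / 96, by norm_num, ?_⟩
  intro r t n m c _ α ε hr ht _ hα hα2 hm hε P hP
  have ht0 : (0 : ℝ) < t := by exact_mod_cast (by omega : 0 < t)
  have ht2 : (2 : ℝ) ≤ t := by exact_mod_cast ht
  rcases Nat.eq_zero_or_pos n with rfl | hn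
  -- For n = 0 the claimed bound is a power of 0 with positive exponent, hence 0.
  · have h1 : 1 - 1 / (t : ℝ) ≠ 0 := by
      have : 1 / (t : ℝ) < 1 := by rw [div_lt_one ht0]; linarith
      linarith
    rw [Nat.cast_zero, zero_div, Real.zero_rpow h1, mul_zero, mul_zero]
    exact Nat.cast_nonneg c
  by_contra! hc
  have hmn : 2 * (m * t) ≤ n := by
    have h1 : (m : ℝ) * t = α * n := by rw [hm]; field_simp
    have h2 : (2 : ℝ) * (m * t) ≤ n := by
      rw [h1]
      nlinarith [(Nat.cast_nonneg n : (0 : ℝ) ≤ n)]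
    exact_mod_cast h2
  obtain ⟨D, hD⟩ := HiddenHypermatching.Protocol.exists_le_successProb P hP (by omega)
  have hε2 : ε ≤ 1 / 2 := by
    linarith [HiddenHypermatching.successProb_le_one (by omega : m * t ≤ n) D]
  have hη := HiddenHypermatching.fourier_parameter_le (by omega : 0 < r) ht hn hα hm hε hε2 hc
  exact absurd hD (not_le.2 (HiddenHypermatching.successProb_lt hr (by omega) hn hmn hε
    (by linarith) hη D))
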